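/- For a compactly supported Borel probability measure $\mu$ on $\mathbb{C}$ let $I(\mu)=\iint \log|z-\zeta|\,d\mu(z)\,d\mu(\zeta)\in[-\infty,\infty)$. For a compact set $K\subset\mathbb{C}$ that carries a probability measure of finite energy, let $\mu_K$ (the equilibrium measure) be the unique probability measure on $K$ that maximizes $I$, and put $\operatorname{cap}(K)=e^{I(\mu_K)}$; otherwise put $\operatorname{cap}(K)=0$. \textbf{Proposition.} Let $K\subset\mathbb{C}$ be a compact connected set with $0\in K$ and $\operatorname{cap}(K)=1$, and let $g(z)=\int_K\log|z-\zeta|\,d\mu_K(\zeta)$, which is the Green function with pole at $\infty$ of the complement of $K$ in the Riemann sphere, extended by this formula to all of $\mathbb{C}$. Let $\varphi\in C^2(\mathbb{R})$ be real-valued and constant near $-\infty$. Then for each $R\ge 4$, with $\mathbb{B}(R)=\{z\in\mathbb{C}:|z|<R\}$, both integrals below converge absolutely, and $$\int_K\varphi(\log|z|)\,d\mu_K(z)=\frac1{2\pi}\int_{\mathbb{B}(R)}g(z)\,\varphi''(\log|z|)\,|z|^{-2}\,dx\,dy+\varphi(\log R)-\varphi'(\log R)\log R .$$ -/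

import Mathlib

open MeasureTheory Set Filter Topology
open scoped ENNReal

noncomputable section

/-- The logarithmic energy `I(μ) = ∬ log |z - ζ| dμ(z) dμ(ζ)` of a compactly supported finite
measure, with values in `[-∞, ∞]`, as the integral of the positive part of the kernel minus that of
its negative part. Here `ENNReal.log 0 = -∞`, so the diagonal is given its true value. For finite
measures with bounded support the first integral is finite, and the difference makes sense. -/
def logEnergy (μ : Measure ℂ) : EReal :=
  ((∫⁻ p, (ENNReal.log ‖p.1 - p.2‖ₑ).toENNReal ∂(μ.prod μ) : ℝ≥0∞) : EReal)
    - ((∫⁻ p, (-ENNReal.log ‖p.1 - p.2‖ₑ).toENNReal ∂(μ.prod μ) : ℝ≥0∞) : EReal)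

/-- `μ` is a Borel probability measure carried by `K`. -/
def IsProbabilityOn (K : Set ℂ) (μ : Measure ℂ) : Prop :=
  IsProbabilityMeasure μ ∧ μ Kᶜ = 0

/-- A compact set is polar if all probability measures on it have energy `-∞`. -/
def IsPolarCompact (K : Set ℂ) : Prop :=
  ∀ μ : Measure ℂ, IsProbabilityOn K μ → logEnergy μ = ⊥

/-- `μ` maximizes the logarithmic energy among all probability measures on `K`. -/
def IsEquilibriumMeasure (K : Set ℂ) (μ : Measure ℂ) : Prop :=
  IsProbabilityOn K μ ∧ ∀ ν : Measure ℂ, IsProbabilityOn K ν → logEnergy ν ≤ logEnergy μ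

open Classical in
/-- The equilibrium measure `μ_K` of a non-polar compact set `K` (which exists and is unique):
the probability measure on `K` with the largest logarithmic energy. -/
def equilibriumMeasure (K : Set ℂ) : Measure ℂ :=
  if h : ∃ μ : Measure ℂ, IsEquilibriumMeasure K μ then h.choose else 0

open Classical in
/-- The logarithmic capacity of a compact set: `exp I(μ_K)`, and `0` if `K` is polar. -/
def logCapacity (K : Set ℂ) : ℝ≥0∞ :=
  if IsPolarCompact K then 0 else EReal.exp (logEnergy (equilibriumMeasure K))

/-- The equilibrium potential `g(z) = ∫_K log |z - ζ| dμ_K(ζ)`. If the compact set `K` has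
capacity `1`, then this is the Green function of the complement of `K` in the Riemann sphere with
pole at infinity. A measure of finite energy has no atoms, so the value of `Real.log` at `0`
plays no role. -/
def equilibriumPotential (K : Set ℂ) (z : ℂ) : ℝ :=
  ∫ ζ in K, Real.log ‖z - ζ‖ ∂(equilibriumMeasure K)

end

/-! Fix `ζ` with `0 < |ζ| ≤ R`. The weight `φ''(log|z|)|z|⁻²` is radial and vanishes near `0`, so in
polar coordinates its pairing with `log|z - ζ|` sees only the circle averages `log max(r, |ζ|)`.
With `t = log r`, the primitive `tφ'(t) - φ(t)` of `tφ''(t)` then gives `2π(log R φ'(log R) - φ(log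
R) + φ(log|ζ|))` (`integral_ball_log_norm_sub_mul`). Integrating in `ζ` against `μ_K` and exchanging
the integrals proves the formula; `integrable_log_norm_sub_mul` justifies the exchange.

Two facts about `μ_K` are needed. It has no atom at `0`, because its energy is finite. It lives in
`|ζ| ≤ 4 ≤ R`: the moduli of a connected `K` containing `0` and `z` fill `[0, |z|]`. Lifting the
arcsine law of this segment to `K` by a measurable section of the modulus does not decrease
distances, so the maximal energy is at least `log(|z|/4)` (`log_norm_div_four_le`), while capacity
one makes it `0`. -/

/-! ### Energy as a constant minus a nonnegative integral; existence of equilibrium measures. -/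

/-- The integral of `C - log |z - w|` against `ν × ν`, in `[0, ∞]`. -/
noncomputable def energyDeficit (C : ℝ) (ν : Measure ℂ) : ℝ≥0∞ :=
  ∫⁻ p, ((C : EReal) - ENNReal.log ‖p.1 - p.2‖ₑ).toENNReal ∂(ν.prod ν)

/-- Continuity includes the diagonal, where the kernel takes the value `∞`; subtracting from `C` is
continuous on `EReal` because `C` is finite. -/
theorem continuous_toENNReal_sub_log (C : ℝ) :
    Continuous fun p : ℂ × ℂ => ((C : EReal) - ENNReal.log ‖p.1 - p.2‖ₑ).toENNReal := by
  have h : Continuous fun x : EReal => (C : EReal) - x := by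
    simp_rw [sub_eq_add_neg]
    refine continuous_iff_continuousAt.2 fun x => ?_
    exact (EReal.continuousAt_add (p := ((C : EReal), -x)) (by simp) (by simp)).comp
      (f := fun x : EReal => ((C : EReal), -x)) (by fun_prop)
  exact EReal.continuous_toENNReal.comp (h.comp (ENNReal.continuous_log.comp (by fun_prop)))

theorem energyDeficit_map (C : ℝ) {X : Type*} [MeasurableSpace X] (ρ : Measure X) [SFinite ρ]
    {g : X → ℂ} (hg : Measurable g) : energyDeficit C (ρ.map g) =
      ∫⁻ p, ((C : EReal) - ENNReal.log ‖g p.1 - g p.2‖ₑ).toENNReal ∂(ρ.prod ρ) := by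
  rw [energyDeficit, Measure.map_prod_map _ _ hg hg,
    lintegral_map (continuous_toENNReal_sub_log C).measurable (hg.prodMap hg)]
  rfl

/-- This is `x⁺ + (C - x) = C + x⁻`, written without subtraction in `[0, ∞]` so that it can be
integrated termwise even where `x = -∞`. -/
theorem toENNReal_add_toENNReal_sub {C : ℝ} (hC : 0 ≤ C) {x : EReal} (hx : x ≤ C) :
    x.toENNReal + ((C : EReal) - x).toENNReal = ENNReal.ofReal C + (-x).toENNReal := by
  induction x using EReal.rec with
  | bot => simp
  | top => simp at hx
  | coe x =>
    rw [EReal.coe_le_coe_iff] at hx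
    rw [← EReal.coe_sub, ← EReal.coe_neg]
    simp only [EReal.real_coe_toENNReal]
    rcases le_total 0 x with h | h
    · rw [← ENNReal.ofReal_add h (by linarith), ENNReal.ofReal_of_nonpos (p := -x) (by linarith)]
      simp
    · rw [← ENNReal.ofReal_add hC (by linarith), ENNReal.ofReal_of_nonpos h, zero_add]
      congr 1

theorem IsProbabilityOn.ae_mem_prod {K : Set ℂ} {ν : Measure ℂ} (hν : IsProbabilityOn K ν) :
    ∀ᵐ p ∂(ν.prod ν), p.1 ∈ K ∧ p.2 ∈ K := by
  have := hν.1
  have h : ∀ᵐ z ∂ν, z ∈ K := hν.2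
  exact (Measure.quasiMeasurePreserving_fst.ae h).and (Measure.quasiMeasurePreserving_snd.ae h)

theorem log_enorm_sub_le {z w : ℂ} {C : ℝ} (h : ‖z - w‖ ≤ Real.exp C) :
    ENNReal.log ‖z - w‖ₑ ≤ C := by
  rw [← ofReal_norm, ENNReal.log_ofReal]
  split_ifs with h0
  · simp
  · rw [EReal.coe_le_coe_iff, Real.log_le_iff_le_exp (not_le.1 h0)]
    exact h

/-- On measures carried by a fixed compact set the energy is a constant minus the deficit. -/
theorem IsProbabilityOn.logEnergy_eq {K : Set ℂ} {ν : Measure ℂ} (hν : IsProbabilityOn K ν)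
    {C : ℝ} (hC : 0 ≤ C) (hKC : ∀ z ∈ K, ∀ w ∈ K, ‖z - w‖ ≤ Real.exp C) :
    logEnergy ν = (C : EReal) - (energyDeficit C ν : EReal) := by
  have := hν.1
  set P := ∫⁻ p, (ENNReal.log ‖p.1 - p.2‖ₑ).toENNReal ∂(ν.prod ν) with hP
  set N := ∫⁻ p, (-ENNReal.log ‖p.1 - p.2‖ₑ).toENNReal ∂(ν.prod ν) with hN
  have hle : ∀ᵐ p ∂(ν.prod ν), ENNReal.log ‖p.1 - p.2‖ₑ ≤ C := by
    filter_upwards [hν.ae_mem_prod] with p hp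
    exact log_enorm_sub_le (hKC _ hp.1 _ hp.2)
  have hsum : P + energyDeficit C ν = ENNReal.ofReal C + N := by
    have hc : ENNReal.ofReal C = ∫⁻ _, ENNReal.ofReal C ∂(ν.prod ν) := by simp
    rw [hP, hN, energyDeficit, hc, ← lintegral_add_left (by fun_prop),
      ← lintegral_add_left (by fun_prop)]
    refine lintegral_congr_ae ?_
    filter_upwards [hle] with p hp
    exact toENNReal_add_toENNReal_sub hC hp
  have hPfin : P ≠ ∞ := by
    refine ne_top_of_le_ne_top (b := ENNReal.ofReal C) ENNReal.ofReal_ne_top ?_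
    calc P ≤ ∫⁻ _, ENNReal.ofReal C ∂(ν.prod ν) := by
          refine lintegral_mono_ae ?_
          filter_upwards [hle] with p hp
          simpa using EReal.toENNReal_le_toENNReal hp
      _ = ENNReal.ofReal C := by simp
  change (P : EReal) - (N : EReal) = _
  generalize energyDeficit C ν = J at *
  clear_value P N
  lift P to NNReal using hPfin
  by_cases hJ : J = ∞
  · subst hJ
    have : N = ∞ := by
      by_contra h
      lift N to NNReal using h
      rw [add_top] at hsum
      exact ENNReal.add_ne_top.2 ⟨ENNReal.ofReal_ne_top, ENNReal.coe_ne_top⟩ hsum.symm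
    subst this
    simp
  · lift J to NNReal using hJ
    have hNf : N ≠ ∞ := by
      rintro rfl
      rw [add_top, ← ENNReal.coe_add] at hsum
      exact ENNReal.coe_ne_top hsum
    lift N to NNReal using hNf
    have h2 : (P : ℝ) + J = C + N := by
      have := congrArg ENNReal.toReal hsum
      rw [ENNReal.toReal_add (by simp) (by simp), ENNReal.toReal_add (by simp) (by simp),
        ENNReal.toReal_ofReal hC] at this
      simpa using this
    have h3 : ((P : ℝ) : EReal) - ((N : ℝ) : EReal) = (C : EReal) - ((J : ℝ) : EReal) := by
      rw [← EReal.coe_sub, ← EReal.coe_sub]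
      congr 1
      linarith
    exact h3

/-- Integration of a nonnegative lower semicontinuous kernel, here given as a continuous function
into `[0, ∞]`, is lower semicontinuous for the weak topology. -/
theorem lowerSemicontinuous_lintegral_of_continuous {X : Type*} [TopologicalSpace X]
    [CompactSpace X] [MeasurableSpace X] [OpensMeasurableSpace X] {f : X → ℝ≥0∞}
    (hf : Continuous f) :
    LowerSemicontinuous fun ν : ProbabilityMeasure X => ∫⁻ x, f x ∂(ν : Measure X) := by
  -- The truncations `min f n` are finite and continuous, so their integrals are weakly continuous;
  -- the integral of `f` is their supremum.
  have hmin : ∀ (n : ℕ) (x : X), min (f x) n ≠ ∞ := fun n x =>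
    ne_top_of_le_ne_top (ENNReal.natCast_ne_top n) (min_le_right _ _)
  let g : ℕ → C(X, NNReal) := fun n =>
    ⟨fun x => (min (f x) n).toNNReal, ENNReal.continuousOn_toNNReal.comp_continuous
      (by fun_prop) (hmin n)⟩
  have hg : ∀ n x, ((g n x : NNReal) : ℝ≥0∞) = min (f x) n := fun n x =>
    ENNReal.coe_toNNReal (hmin n x)
  have hsup : ∀ x, f x = ⨆ n, ((g n x : NNReal) : ℝ≥0∞) := fun x => by
    simp_rw [hg]
    exact ((inf_iSup_eq (f x) fun n : ℕ => (n : ℝ≥0∞)).symm.trans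
      (by rw [ENNReal.iSup_natCast, inf_top_eq])).symm
  have : (fun ν : ProbabilityMeasure X => ∫⁻ x, f x ∂(ν : Measure X)) =
      fun ν : ProbabilityMeasure X => ⨆ n, ∫⁻ x, (g n x : ℝ≥0∞) ∂(ν : Measure X) := by
    funext ν
    simp_rw [hsup]
    refine lintegral_iSup (fun n => (g n).continuous.measurable.coe_nnreal_ennreal) ?_
    intro m n hmn x
    simp only [hg]
    gcongr
  rw [this]
  exact lowerSemicontinuous_iSup fun n =>
    (ProbabilityMeasure.continuous_lintegral_continuousMap (g n)).lowerSemicontinuous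

theorem exists_norm_sub_le_exp {K : Set ℂ} (hK : IsCompact K) :
    ∃ C : ℝ, 0 ≤ C ∧ ∀ z ∈ K, ∀ w ∈ K, ‖z - w‖ ≤ Real.exp C := by
  refine ⟨Metric.diam K, Metric.diam_nonneg, fun z hz w hw => ?_⟩
  rw [← dist_eq_norm]
  have := Real.add_one_le_exp (Metric.diam K)
  linarith [Metric.dist_le_diam_of_mem hK.isBounded hz hw]

/-- The deficit is lower semicontinuous on the weakly compact space of probability measures on `K`,
since `ν ↦ ν × ν` is continuous; hence it attains its minimum. Without existence,
`equilibriumMeasure` would be the default `0`. -/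
theorem exists_isEquilibriumMeasure {K : Set ℂ} (hK : IsCompact K) (hne : K.Nonempty) :
    ∃ μ, IsEquilibriumMeasure K μ := by
  obtain ⟨C, hC, hKC⟩ := exists_norm_sub_le_exp hK
  have : CompactSpace K := isCompact_iff_compactSpace.1 hK
  obtain ⟨z₀, hz₀⟩ := hne
  have hme : MeasurableEmbedding (Subtype.val : K → ℂ) :=
    MeasurableEmbedding.subtype_coe hK.measurableSet
  obtain ⟨J, hJdef⟩ : ∃ J : ProbabilityMeasure K → ℝ≥0∞,
      ∀ ν, J ν = energyDeficit C ((ν : Measure K).map (↑)) := ⟨_, fun _ => rfl⟩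
  obtain ⟨k, hk⟩ : ∃ k : ℂ × ℂ → ℝ≥0∞, k = fun p =>
      ((C : EReal) - ENNReal.log ‖p.1 - p.2‖ₑ).toENNReal := ⟨_, rfl⟩
  have hkc : Continuous k := hk ▸ continuous_toENNReal_sub_log C
  have hfc : Continuous fun p : K × K => k (p.1, p.2) := by fun_prop
  have hJ : ∀ ν, J ν = ∫⁻ p : K × K, k (p.1, p.2) ∂((ν.prod ν : ProbabilityMeasure (K × K)) :
      Measure (K × K)) := fun ν => by
    rw [hJdef, energyDeficit_map C _ hme.measurable, hk, ProbabilityMeasure.toMeasure_prod]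
  have hlsc : LowerSemicontinuous J := by
    have h1 := lowerSemicontinuous_lintegral_of_continuous hfc
    have h2 : Continuous fun ν : ProbabilityMeasure K => ν.prod ν :=
      ProbabilityMeasure.continuous_prod.comp (by fun_prop :
        Continuous fun ν : ProbabilityMeasure K => (ν, ν))
    rw [funext hJ]
    exact h1.comp h2
  have : Nonempty (ProbabilityMeasure K) := ⟨⟨Measure.dirac ⟨z₀, hz₀⟩, inferInstance⟩⟩
  obtain ⟨ν₀, -, hν₀⟩ := (hlsc.lowerSemicontinuousOn univ).exists_isMinOn univ_nonempty
    isCompact_univ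
  have hon : ∀ ν : ProbabilityMeasure K, IsProbabilityOn K ((ν : Measure K).map (↑)) := fun ν =>
    ⟨Measure.isProbabilityMeasure_map hme.measurable.aemeasurable, by
      rw [Measure.map_apply hme.measurable hK.measurableSet.compl]
      simp⟩
  refine ⟨_, hon ν₀, fun ν hν => ?_⟩
  have := hν.1
  have hK1 : ν K = 1 := (prob_compl_eq_zero_iff hK.measurableSet).1 hν.2
  have hcomap : (ν.comap (Subtype.val : K → ℂ)).map Subtype.val = ν := by
    rw [hme.map_comap, Subtype.range_coe, Measure.restrict_eq_self_of_ae_mem]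
    exact hν.2
  have hprob : IsProbabilityMeasure (ν.comap (Subtype.val : K → ℂ)) :=
    ⟨by rw [hme.comap_apply, image_univ, Subtype.range_coe, hK1]⟩
  obtain ⟨ν', hν'⟩ : ∃ ν' : ProbabilityMeasure K, (ν' : Measure K) = ν.comap (↑) :=
    ⟨⟨_, hprob⟩, rfl⟩
  have hmin : J ν₀ ≤ J ν' := hν₀ (mem_univ _)
  have hJν : J ν' = energyDeficit C ν := by
    rw [hJdef, hν', hcomap]
  rw [hν.logEnergy_eq hC hKC, (hon ν₀).logEnergy_eq hC hKC]
  rw [hJν, hJdef] at hmin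
  exact EReal.sub_le_sub le_rfl (EReal.coe_ennreal_le_coe_ennreal_iff.2 hmin)

theorem isEquilibriumMeasure_equilibriumMeasure {K : Set ℂ} (hK : IsCompact K)
    (hne : K.Nonempty) : IsEquilibriumMeasure K (equilibriumMeasure K) := by
  have h := exists_isEquilibriumMeasure hK hne
  rw [equilibriumMeasure, dif_pos h]
  exact h.choose_spec

theorem logEnergy_equilibriumMeasure_of_logCapacity_eq_one {K : Set ℂ} (h : logCapacity K = 1) :
    logEnergy (equilibriumMeasure K) = 0 := by
  rw [logCapacity] at h
  split_ifs at h with hp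
  · simp at h
  · simpa using congrArg ENNReal.log h

/-- A measure of finite energy has no atoms. -/
theorem IsProbabilityOn.measure_singleton_eq_zero {K : Set ℂ} {ν : Measure ℂ} (hK : IsCompact K)
    (hν : IsProbabilityOn K ν) (h : logEnergy ν ≠ ⊥) (z : ℂ) : ν {z} = 0 := by
  have := hν.1
  obtain ⟨C, hC, hKC⟩ := exists_norm_sub_le_exp hK
  rw [hν.logEnergy_eq hC hKC] at h
  have hJ : energyDeficit C ν ≠ ∞ := by
    intro hJ
    simp [hJ] at h
  -- The kernel is `∞` on the diagonal, so a finite integral makes `{z} × {z}` null.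
  have hae := ae_lt_top (continuous_toENNReal_sub_log C).measurable hJ
  have h0 : (ν.prod ν) ({z} ×ˢ {z}) = 0 := by
    refine measure_mono_null (fun p hp => ?_) hae
    have h1 : p.1 = z := hp.1
    have h2 : p.2 = z := hp.2
    simp [h1, h2]
  rw [Measure.prod_prod] at h0
  exact mul_self_eq_zero.1 h0

/-! ### Circular projection and the bound `|z| ≤ 4`. -/

/-- The modulus has a Borel measurable section over its image of a compact set. -/
theorem exists_measurable_norm_section {K : Set ℂ} (hK : IsCompact K) :
    ∃ L : ℝ → ℂ, Measurable L ∧ ∀ t ∈ norm '' K, L t ∈ K ∧ ‖L t‖ = t := by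
  have hT : IsClosed (norm '' K : Set ℝ) := (hK.image continuous_norm).isClosed
  -- On each circle the section picks a point of `K` with the largest real part; the modulus then
  -- determines the imaginary part up to sign.
  let A : ℝ → Set ℝ := fun t => Complex.re '' (K ∩ {z | ‖z‖ = t})
  have hA : ∀ t, IsCompact (A t) := fun t =>
    (hK.inter_right (isClosed_eq continuous_norm continuous_const)).image Complex.continuous_re
  have hne : ∀ t ∈ norm '' K, (A t).Nonempty := by
    rintro t ⟨z, hz, rfl⟩
    exact ⟨z.re, z, ⟨hz, rfl⟩, rfl⟩
  let s : ℝ → ℝ := fun t => sSup (A t)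
  have hs : ∀ t ∈ norm '' K, s t ∈ A t := fun t ht => (hA t).sSup_mem (hne t ht)
  have hsm : Measurable s := by
    refine measurable_of_Ici fun c => ?_
    -- Off the image of `K` the supremum of the empty set is `0`, which accounts for the second
    -- piece.
    have : s ⁻¹' Ici c = norm '' (K ∩ {z | c ≤ z.re}) ∪ ((norm '' K)ᶜ ∩ {_t | c ≤ 0}) := by
      ext t
      by_cases ht : t ∈ norm '' K
      · simp only [mem_preimage, mem_Ici, mem_union, mem_inter_iff, mem_compl_iff, ht,
          not_true_eq_false, false_and, or_false]
        constructor
        · intro hc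
          obtain ⟨z, ⟨hz, hzt⟩, hzs⟩ := hs t ht
          exact ⟨z, ⟨hz, by simpa [hzs] using hc⟩, hzt⟩
        · rintro ⟨z, ⟨hz, hc⟩, hzt⟩
          exact le_trans hc (le_csSup (hA t).bddAbove ⟨z, ⟨hz, hzt⟩, rfl⟩)
      · have hemp : A t = ∅ := by
          refine eq_empty_iff_forall_notMem.2 ?_
          rintro _ ⟨z, ⟨hz, hzt⟩, rfl⟩
          exact ht ⟨z, hz, hzt⟩
        have hn : t ∉ norm '' (K ∩ {z | c ≤ z.re}) := fun ⟨z, hz, hzt⟩ => ht ⟨z, hz.1, hzt⟩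
        simp only [mem_preimage, mem_Ici, mem_union, mem_inter_iff, mem_compl_iff, ht, hn,
          not_false_eq_true, true_and, false_or, s, hemp, Real.sSup_empty, mem_ofPred_eq]
    rw [this]
    refine ((hK.inter_right (isClosed_le continuous_const Complex.continuous_re)).image
      continuous_norm).isClosed.measurableSet.union (hT.measurableSet.compl.inter ?_)
    exact MeasurableSet.const _
  let u : ℝ → ℂ := fun t => ⟨s t, Real.sqrt (t ^ 2 - s t ^ 2)⟩
  have hum : Measurable u := by
    have : u = fun t => (s t : ℂ) + (Real.sqrt (t ^ 2 - s t ^ 2) : ℂ) * Complex.I := by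
      funext t
      exact Complex.mk_eq_add_mul_I _ _
    rw [this]
    fun_prop
  classical
  -- `u t` has nonnegative imaginary part; if it misses `K`, its conjugate lies in `K`.
  refine ⟨fun t => if u t ∈ K then u t else (starRingEnd ℂ) (u t),
    Measurable.ite (hum hK.measurableSet) hum (Complex.continuous_conj.measurable.comp hum), ?_⟩
  intro t ht
  obtain ⟨z, ⟨hz, hzt⟩, hzs⟩ := hs t ht
  have hzt' : ‖z‖ = t := hzt
  have him : z.im ^ 2 = t ^ 2 - s t ^ 2 := by
    rw [← hzs, ← hzt', Complex.sq_norm, Complex.normSq_apply]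
    ring
  have hor : z = u t ∨ z = (starRingEnd ℂ) (u t) := by
    have : Real.sqrt (t ^ 2 - s t ^ 2) = |z.im| := by rw [← him, Real.sqrt_sq_eq_abs]
    rcases abs_cases z.im with ⟨h, -⟩ | ⟨h, -⟩
    · left
      apply Complex.ext <;> simp [u, this, h, hzs]
    · right
      apply Complex.ext <;> simp [u, this, h, hzs]
  have hnu : ‖u t‖ = t := by
    rcases hor with h | h
    · rw [← h, hzt']
    · rw [← RCLike.norm_conj (u t), ← h, hzt']
  dsimp only
  split_ifs with hu
  · exact ⟨hu, hnu⟩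
  · rcases hor with h | h
    · exact absurd (h ▸ hz) hu
    · exact ⟨h ▸ hz, by rw [RCLike.norm_conj, hnu]⟩

/-- The uniform probability measure on `(0, 2π]`. -/
noncomputable def uniformAngle : Measure ℝ :=
  (ENNReal.ofReal (2 * Real.pi))⁻¹ • volume.restrict (Ioc 0 (2 * Real.pi))

instance : IsProbabilityMeasure uniformAngle := by
  constructor
  rw [uniformAngle, Measure.smul_apply, Measure.restrict_apply_univ, Real.volume_Ioc, sub_zero,
    smul_eq_mul, ENNReal.inv_mul_cancel]
  · simpa using Real.pi_pos
  · exact ENNReal.ofReal_ne_top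

/-- The identity `(e^{ix} - e^{iy})(e^{ix} - e^{-iy}) = 2e^{ix}(cos x - cos y)` reduces potentials
of the arcsine law to those of the uniform measure on the unit circle, which vanish at points of
that circle. -/
theorem abs_cos_sub_cos_eq (x y : ℝ) : |Real.cos x - Real.cos y| =
    2⁻¹ * (‖circleMap 0 1 x - circleMap 0 1 y‖ * ‖circleMap 0 1 x - circleMap 0 1 (-y)‖) := by
  have hu : ‖circleMap 0 1 x‖ = 1 := by simp
  have hx : circleMap 0 1 x = Real.cos x + Real.sin x * Complex.I := by
    simp [circleMap, Complex.exp_mul_I]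
  have hy : circleMap 0 1 y = Real.cos y + Real.sin y * Complex.I := by
    simp [circleMap, Complex.exp_mul_I]
  have hy' : circleMap 0 1 (-y) = Real.cos y - Real.sin y * Complex.I := by
    simp only [circleMap, Complex.ofReal_one, one_mul, zero_add,
      Complex.ofReal_neg, Complex.ofReal_cos, Complex.ofReal_sin]
    rw [Complex.exp_mul_I, Complex.cos_neg, Complex.sin_neg]
    ring
  have key : (circleMap 0 1 x - circleMap 0 1 y) * (circleMap 0 1 x - circleMap 0 1 (-y)) =
      2 * circleMap 0 1 x * ((Real.cos x - Real.cos y : ℝ) : ℂ) := by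
    have h1 := Real.sin_sq_add_cos_sq x
    have h2 := Real.sin_sq_add_cos_sq y
    rw [hx, hy, hy']
    generalize Real.cos x = c at *
    generalize Real.sin x = s at *
    generalize Real.cos y = c' at *
    generalize Real.sin y = s' at *
    apply Complex.ext
    · simp
      linear_combination h2 - h1
    · simp
      ring
  rw [← norm_mul, key, norm_mul, norm_mul, hu, Complex.norm_real, Real.norm_eq_abs]
  simp

theorem integrable_uniformAngle_log_norm_circleMap_sub (a : ℂ) :
    Integrable (fun x => Real.log ‖circleMap 0 1 x - a‖) uniformAngle := by
  have h : CircleIntegrable (fun z => Real.log ‖z - a‖) 0 1 :=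
    circleIntegrable_log_norm_sub_const 1
  have h2 := (intervalIntegrable_iff_integrableOn_Ioc_of_le (by positivity)).1 h
  exact Integrable.smul_measure h2 (by simpa using Real.pi_pos)

theorem integral_uniformAngle (f : ℂ → ℝ) :
    ∫ x, f (circleMap 0 1 x) ∂uniformAngle = Real.circleAverage f 0 1 := by
  rw [uniformAngle, integral_smul_measure, Real.circleAverage_def,
    intervalIntegral.integral_of_le (by positivity), ENNReal.toReal_inv,
    ENNReal.toReal_ofReal (by positivity)]

theorem integral_uniformAngle_log_norm_circleMap_sub {a : ℂ} (ha : ‖a‖ = 1) :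
    ∫ x, Real.log ‖circleMap 0 1 x - a‖ ∂uniformAngle = 0 := by
  rw [integral_uniformAngle (fun z => Real.log ‖z - a‖)]
  exact circleAverage_log_norm_sub_const₁ ha

/-- The projection of the uniform measure on the circle to a diameter has logarithmic energy
`-log 2`, in terms of potentials. -/
theorem lintegral_uniformAngle_sub_log_le {r C : ℝ} (hr : 0 < r) (hC : Real.log r ≤ C) (y : ℝ) :
    ∫⁻ x, ((C : EReal) - ENNReal.log
      ‖r * (1 + Real.cos x) / 2 - r * (1 + Real.cos y) / 2‖ₑ).toENNReal ∂uniformAngle ≤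
        ENNReal.ofReal (C - Real.log (r / 4)) := by
  set a := circleMap 0 1 y with ha
  set b := circleMap 0 1 (-y) with hb
  have hdiff0 : ∀ x, ‖r * (1 + Real.cos x) / 2 - r * (1 + Real.cos y) / 2‖ =
      r / 2 * |Real.cos x - Real.cos y| := fun x => by
    rw [Real.norm_eq_abs, show r * (1 + Real.cos x) / 2 - r * (1 + Real.cos y) / 2 =
      r / 2 * (Real.cos x - Real.cos y) by ring, abs_mul, abs_of_pos (half_pos hr)]
  have hdiff : ∀ x, ‖r * (1 + Real.cos x) / 2 - r * (1 + Real.cos y) / 2‖ =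
      r / 4 * (‖circleMap 0 1 x - a‖ * ‖circleMap 0 1 x - b‖) := fun x => by
    rw [hdiff0, abs_cos_sub_cos_eq]
    ring
  have hle : ∀ x, ‖r * (1 + Real.cos x) / 2 - r * (1 + Real.cos y) / 2‖ ≤ r := fun x => by
    have : |Real.cos x - Real.cos y| ≤ 2 := by
      rw [abs_le]
      constructor <;> linarith [Real.cos_le_one x, Real.cos_le_one y, Real.neg_one_le_cos x,
        Real.neg_one_le_cos y]
    rw [hdiff0]
    nlinarith
  have hac : uniformAngle ≪ volume :=
    (Measure.smul_absolutelyContinuous).trans Measure.restrict_le_self.absolutelyContinuous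
  have hae : ∀ c : ℂ, ∀ᵐ x ∂uniformAngle, 0 < ‖circleMap 0 1 x - c‖ := fun c => by
    have : ((circleMap 0 1) ⁻¹' {c}).Countable := (countable_singleton c).preimage_circleMap 0
      one_ne_zero
    filter_upwards [hac.ae_le (this.ae_notMem volume)] with x hx
    exact norm_pos_iff.2 (sub_ne_zero.2 hx)
  have hr4 : 0 < r / 4 := by positivity
  set h : ℝ → ℝ := fun x => C - Real.log (r / 4) - Real.log ‖circleMap 0 1 x - a‖ -
    Real.log ‖circleMap 0 1 x - b‖ with hh
  have hlog : ∀ᵐ x ∂uniformAngle, 0 ≤ h x ∧ ((C : EReal) - ENNReal.log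
      ‖r * (1 + Real.cos x) / 2 - r * (1 + Real.cos y) / 2‖ₑ).toENNReal =
        ENNReal.ofReal (h x) := by
    filter_upwards [hae a, hae b] with x hxa hxb
    have hpos : 0 < ‖r * (1 + Real.cos x) / 2 - r * (1 + Real.cos y) / 2‖ := by
      rw [hdiff]
      positivity
    have heq : h x = C - Real.log ‖r * (1 + Real.cos x) / 2 - r * (1 + Real.cos y) / 2‖ := by
      rw [hdiff, Real.log_mul hr4.ne' (by positivity), Real.log_mul hxa.ne' hxb.ne', hh]
      ring
    refine ⟨?_, ?_⟩
    · rw [heq, sub_nonneg]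
      exact (Real.log_le_log hpos (hle x)).trans hC
    · rw [← ofReal_norm, ENNReal.log_ofReal_of_pos hpos, ← EReal.coe_sub,
        EReal.real_coe_toENNReal, heq]
  have hia := integrable_uniformAngle_log_norm_circleMap_sub a
  have hib := integrable_uniformAngle_log_norm_circleMap_sub b
  have hint : Integrable h uniformAngle := ((integrable_const _).sub hia).sub hib
  have hval : ∫ x, h x ∂uniformAngle = C - Real.log (r / 4) := by
    rw [hh, integral_sub (f := fun x => C - Real.log (r / 4) - Real.log ‖circleMap 0 1 x - a‖)
      ((integrable_const _).sub hia) hib, integral_sub (integrable_const _) hia,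
      integral_uniformAngle_log_norm_circleMap_sub (by simp [ha]),
      integral_uniformAngle_log_norm_circleMap_sub (by simp [hb])]
    simp
  rw [lintegral_congr_ae (hlog.mono fun x hx => hx.2),
    ← ofReal_integral_eq_lintegral_ofReal hint (hlog.mono fun x hx => hx.1), hval]

/-- Circular projection decreases distances, so the energy of a connected compact set containing
the origin is at least that of a segment. -/
theorem log_norm_div_four_le {K : Set ℂ} (hK : IsCompact K) (hconn : IsConnected K)
    (h0 : (0 : ℂ) ∈ K) {μ : Measure ℂ} (hμ : IsEquilibriumMeasure K μ) {z : ℂ} (hz : z ∈ K)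
    (hz0 : z ≠ 0) : (Real.log (‖z‖ / 4) : EReal) ≤ logEnergy μ := by
  obtain ⟨C, hC, hKC⟩ := exists_norm_sub_le_exp hK
  obtain ⟨L, hL, hLK⟩ := exists_measurable_norm_section hK
  set r := ‖z‖ with hr
  have hr0 : 0 < r := norm_pos_iff.2 hz0
  have hrC : Real.log r ≤ C := by
    rw [Real.log_le_iff_le_exp hr0]
    simpa using hKC z hz 0 h0
  -- For a uniform angle this is the arcsine law on `[0, r]`, a segment of capacity `r / 4`.
  let ξ : ℝ → ℝ := fun x => r * (1 + Real.cos x) / 2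
  have hξ : ∀ x, ξ x ∈ norm '' K := fun x => by
    have hsub : Icc ‖(0 : ℂ)‖ ‖z‖ ⊆ norm '' K :=
      hconn.isPreconnected.intermediate_value h0 hz continuous_norm.continuousOn
    refine hsub ⟨?_, ?_⟩
    · rw [norm_zero]
      have := Real.neg_one_le_cos x
      exact div_nonneg (mul_nonneg hr0.le (by linarith)) (by norm_num)
    · have := Real.cos_le_one x
      change r * (1 + Real.cos x) / 2 ≤ r
      nlinarith
  have hξm : Measurable ξ := by fun_prop
  have hm : Measurable fun x => L (ξ x) := hL.comp hξm
  set ν := uniformAngle.map fun x => L (ξ x) with hνdef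
  have hν : IsProbabilityOn K ν := by
    refine ⟨Measure.isProbabilityMeasure_map hm.aemeasurable, ?_⟩
    rw [hνdef, Measure.map_apply hm hK.measurableSet.compl]
    convert measure_empty (μ := uniformAngle)
    exact eq_empty_iff_forall_notMem.2 fun x hx => hx (hLK _ (hξ x)).1
  have hJ : energyDeficit C ν ≤ ENNReal.ofReal (C - Real.log (r / 4)) := by
    rw [hνdef, energyDeficit_map C _ hm]
    calc ∫⁻ p, ((C : EReal) - ENNReal.log ‖L (ξ p.1) - L (ξ p.2)‖ₑ).toENNReal
          ∂(uniformAngle.prod uniformAngle)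
        ≤ ∫⁻ p, ((C : EReal) - ENNReal.log ‖ξ p.1 - ξ p.2‖ₑ).toENNReal
          ∂(uniformAngle.prod uniformAngle) := by
          refine lintegral_mono fun p => EReal.toENNReal_le_toENNReal
            (EReal.sub_le_sub le_rfl (ENNReal.log_le_log ?_))
          rw [← ofReal_norm, ← ofReal_norm]
          refine ENNReal.ofReal_le_ofReal ?_
          have := abs_norm_sub_norm_le (L (ξ p.1)) (L (ξ p.2))
          rwa [(hLK _ (hξ p.1)).2, (hLK _ (hξ p.2)).2] at this
      _ ≤ ∫⁻ y, ∫⁻ x, ((C : EReal) - ENNReal.log ‖ξ x - ξ y‖ₑ).toENNReal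
          ∂uniformAngle ∂uniformAngle := by
          rw [lintegral_prod_symm']
          have h1 : Measurable fun p : ℝ × ℝ => ((ξ p.1 : ℂ), (ξ p.2 : ℂ)) := by fun_prop
          have h2 := (continuous_toENNReal_sub_log C).measurable.comp h1
          simpa only [Function.comp_def, ← ofReal_norm, ← Complex.ofReal_sub, Complex.norm_real]
            using h2
      _ ≤ ∫⁻ _, ENNReal.ofReal (C - Real.log (r / 4)) ∂uniformAngle :=
          lintegral_mono fun y => lintegral_uniformAngle_sub_log_le hr0 hrC y
      _ = _ := by simp
  have hnn : 0 ≤ C - Real.log (r / 4) := by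
    have := Real.log_nonneg (x := 4) (by norm_num)
    rw [Real.log_div hr0.ne' (by norm_num)]
    linarith
  refine le_trans ?_ (hμ.2 ν hν)
  rw [hν.logEnergy_eq hC hKC]
  have h1 : (energyDeficit C ν : EReal) ≤ ((C - Real.log (r / 4) : ℝ) : EReal) := by
    refine (EReal.coe_ennreal_le_coe_ennreal_iff.2 hJ).trans_eq ?_
    rw [EReal.coe_ennreal_ofReal, max_eq_left hnn]
  refine le_trans ?_ (EReal.sub_le_sub (le_refl (C : EReal)) h1)
  rw [← EReal.coe_sub, sub_sub_cancel]

theorem norm_le_four_of_logCapacity_eq_one {K : Set ℂ} (hK : IsCompact K) (hconn : IsConnected K)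
    (h0 : (0 : ℂ) ∈ K) (hcap : logCapacity K = 1) {z : ℂ} (hz : z ∈ K) : ‖z‖ ≤ 4 := by
  rcases eq_or_ne z 0 with rfl | hz0
  · simp
  have h := log_norm_div_four_le hK hconn h0
    (isEquilibriumMeasure_equilibriumMeasure hK ⟨0, h0⟩) hz hz0
  rw [logEnergy_equilibriumMeasure_of_logCapacity_eq_one hcap] at h
  have h2 : Real.log (‖z‖ / 4) ≤ 0 := by exact_mod_cast h
  have hpos : 0 < ‖z‖ / 4 := by positivity
  have := (Real.log_nonpos_iff hpos.le).1 h2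
  linarith

/-! ### Polar coordinates and integrability of the logarithmic kernel. -/

theorem Continuous.exists_abs_le_of_eventuallyEq_const_atBot {ψ : ℝ → ℝ} (hψ : Continuous ψ)
    {c : ℝ} (hc : ∀ᶠ t in atBot, ψ t = c) (l : ℝ) : ∃ B, 0 ≤ B ∧ ∀ t ≤ l, |ψ t| ≤ B := by
  obtain ⟨T, hT⟩ := eventually_atBot.1 hc
  obtain ⟨B, hB⟩ := (isCompact_Icc (a := T) (b := l)).exists_bound_of_continuousOn
    hψ.continuousOn
  refine ⟨max B |c|, le_max_of_le_right (abs_nonneg c), fun t ht => ?_⟩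
  rcases le_total t T with h | h
  · rw [hT t h]
    exact le_max_right _ _
  · exact (hB t ⟨h, ht⟩).trans (le_max_left _ _)

theorem integrable_smul_comp_polarCoord_symm {f : ℂ → ℝ} (hfm : Measurable f)
    (hf : Integrable f) :
    IntegrableOn (fun p : ℝ × ℝ => p.1 • f (Complex.polarCoord.symm p)) polarCoord.target := by
  have hm : Measurable fun p : ℝ × ℝ => p.1 • f (Complex.polarCoord.symm p) := by
    simp only [Complex.polarCoord_symm_apply]
    fun_prop
  refine ⟨hm.aestronglyMeasurable, ?_⟩
  have h := hf.hasFiniteIntegral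
  rw [HasFiniteIntegral, ← Complex.lintegral_comp_polarCoord_symm] at h
  rw [HasFiniteIntegral]
  refine lt_of_eq_of_lt ?_ h
  refine setLIntegral_congr_fun polarCoord.open_target.measurableSet fun p hp => ?_
  have hp1 : 0 < p.1 := hp.1
  simp only [smul_eq_mul, enorm_mul, Real.enorm_eq_ofReal hp1.le]

/-- Integration in the plane in terms of circle averages. -/
theorem integral_eq_integral_circleAverage {f : ℂ → ℝ} (hfm : Measurable f) (hf : Integrable f) :
    ∫ z, f z = ∫ r in Ioi (0 : ℝ), 2 * Real.pi * (r * Real.circleAverage f 0 r) := by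
  have h := integrable_smul_comp_polarCoord_symm hfm hf
  rw [← Complex.integral_comp_polarCoord_symm]
  rw [polarCoord_target] at h ⊢
  rw [Measure.volume_eq_prod] at h ⊢
  rw [setIntegral_prod _ h]
  refine setIntegral_congr_fun measurableSet_Ioi fun r _ => ?_
  have hc : ∀ θ : ℝ, Complex.polarCoord.symm (r, θ) = circleMap 0 r θ := fun θ => by
    simp [circleMap, Complex.exp_mul_I]
  simp only [hc, smul_eq_mul, integral_const_mul]
  -- The polar angle runs over `(-π, π)`, the circle average over `[0, 2π]`; a shift by `-π`
  -- reconciles them.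
  rw [Real.circleAverage_eq_integral_add (-Real.pi),
    intervalIntegral.integral_comp_add_right (fun θ => f (circleMap 0 r θ)), zero_add,
    show 2 * Real.pi + -Real.pi = Real.pi by ring,
    intervalIntegral.integral_of_le (by linarith [Real.pi_pos]),
    integral_Ioc_eq_integral_Ioo, smul_eq_mul]
  field_simp

/-- The Jacobian tames the singularity: `r log r` is bounded on `[0, ρ]`. -/
theorem integrableOn_log_norm_ball (ρ : ℝ) :
    IntegrableOn (fun z : ℂ => Real.log ‖z‖) (Metric.ball 0 ρ) := by
  have hm : Measurable fun z : ℂ => Real.log ‖z‖ := by fun_prop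
  refine ⟨hm.aestronglyMeasurable, ?_⟩
  rw [HasFiniteIntegral, ← lintegral_indicator measurableSet_ball,
    ← Complex.lintegral_comp_polarCoord_symm]
  obtain ⟨B, hB⟩ := (isCompact_Icc (a := (0 : ℝ)) (b := ρ)).exists_bound_of_continuousOn
    Real.continuous_mul_log.continuousOn
  have hle : ∀ p ∈ polarCoord.target, ENNReal.ofReal p.1 •
      (Metric.ball (0 : ℂ) ρ).indicator (fun z => ‖Real.log ‖z‖‖ₑ)
        (Complex.polarCoord.symm p) ≤
      (Ioo 0 ρ ×ˢ Ioo (-Real.pi) Real.pi).indicator (fun _ => ENNReal.ofReal B) p := by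
    rintro ⟨r, θ⟩ hp
    have hr : 0 < r := hp.1
    have hθ : θ ∈ Ioo (-Real.pi) Real.pi := hp.2
    by_cases h : Complex.polarCoord.symm (r, θ) ∈ Metric.ball (0 : ℂ) ρ
    · have hn : ‖Complex.polarCoord.symm (r, θ)‖ = r := by
        rw [Complex.norm_polarCoord_symm, abs_of_pos hr]
      have hrρ : r < ρ := by rwa [mem_ball_zero_iff, hn] at h
      have hmem : (r, θ) ∈ Ioo 0 ρ ×ˢ Ioo (-Real.pi) Real.pi := ⟨⟨hr, hrρ⟩, hθ⟩
      rw [indicator_of_mem h, indicator_of_mem hmem, hn, smul_eq_mul,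
        ← Real.enorm_eq_ofReal hr.le, ← enorm_mul, ← ofReal_norm]
      exact ENNReal.ofReal_le_ofReal (hB r ⟨hr.le, hrρ.le⟩)
    · rw [indicator_of_notMem h]
      simp
  refine lt_of_le_of_lt (setLIntegral_mono' polarCoord.open_target.measurableSet hle) ?_
  refine lt_of_le_of_lt (setLIntegral_le_lintegral _ _) ?_
  rw [lintegral_indicator (measurableSet_Ioo.prod measurableSet_Ioo), setLIntegral_const,
    Measure.volume_eq_prod, Measure.prod_prod]
  simp [ENNReal.mul_lt_top_iff]

/-- Translating by `ζ` moves the ball into a larger one independent of `ζ`; this uniform bound is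
what Fubini needs. -/
theorem lintegral_ball_log_norm_sub_le {ζ : ℂ} {s R : ℝ} (hζ : ‖ζ‖ ≤ s) :
    ∫⁻ z in Metric.ball 0 R, ‖Real.log ‖z - ζ‖‖ₑ ≤
      ∫⁻ z in Metric.ball (0 : ℂ) (R + s), ‖Real.log ‖z‖‖ₑ := by
  rw [← lintegral_indicator measurableSet_ball, ← lintegral_indicator measurableSet_ball,
    ← lintegral_sub_right_eq_self ((Metric.ball (0 : ℂ) (R + s)).indicator _) ζ]
  refine lintegral_mono fun z => ?_
  by_cases hz : z ∈ Metric.ball (0 : ℂ) R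
  · have : z - ζ ∈ Metric.ball (0 : ℂ) (R + s) := by
      rw [mem_ball_zero_iff] at hz ⊢
      linarith [norm_sub_le z ζ]
    rw [indicator_of_mem hz, indicator_of_mem this]
  · rw [indicator_of_notMem hz]
    exact zero_le

theorem circleAverage_log_norm_sub_eq_log_max {r : ℝ} (hr : 0 < r) (ζ : ℂ) :
    Real.circleAverage (fun z => Real.log ‖z - ζ‖) 0 r = Real.log (max r ‖ζ‖) := by
  rw [circleAverage_log_norm_sub_const_eq_log_radius_add_posLog hr.ne', zero_sub, norm_neg]
  rcases le_total ‖ζ‖ r with h | h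
  · rw [max_eq_left h, (Real.posLog_eq_zero_iff _).2, add_zero]
    rw [abs_of_nonneg (by positivity)]
    exact inv_mul_le_one_of_le₀ h hr.le
  · have hz : 0 < ‖ζ‖ := hr.trans_le h
    rw [max_eq_right h, Real.posLog_eq_log, Real.log_mul (by positivity) hz.ne', Real.log_inv]
    · ring
    · rw [abs_of_nonneg (by positivity), ← div_eq_inv_mul]
      exact (one_le_div hr).2 h

theorem deriv_eq_zero_of_forall_lt_eq {f : ℝ → ℝ} {T c : ℝ} (h : ∀ t < T, f t = c) :
    ∀ t < T, deriv f t = 0 := fun t ht => by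
  have : f =ᶠ[𝓝 t] fun _ => c := by
    filter_upwards [Iio_mem_nhds ht] with u hu using h u hu
  rw [this.deriv_eq, deriv_const]

/-! ### The radial identity for a single pole. -/

/-- Integration by parts in logarithmic coordinates. -/
theorem integral_log_max_mul_deriv_deriv {φ : ℝ → ℝ} (hφ : ContDiff ℝ 2 φ) {c : ℝ}
    (hconst : ∀ᶠ t in atBot, φ t = c) {ρ R : ℝ} (hρ : 0 < ρ) (hρR : ρ ≤ R) :
    ∫ r in Ioo 0 R, r * (Real.log (max r ρ) * (deriv (deriv φ) (Real.log r) * (r ^ 2)⁻¹)) =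
      Real.log R * deriv φ (Real.log R) - φ (Real.log R) + φ (Real.log ρ) := by
  obtain ⟨T, hT⟩ := eventually_atBot.1 hconst
  have hd0 : ∀ t < T, deriv φ t = 0 := deriv_eq_zero_of_forall_lt_eq fun t ht => hT t ht.le
  have hdd0 : ∀ t < T, deriv (deriv φ) t = 0 := deriv_eq_zero_of_forall_lt_eq hd0
  have hφ1 : ContDiff ℝ 1 (deriv φ) :=
    ((contDiff_succ_iff_deriv (n := 1)).1 (by simpa [one_add_one_eq_two] using hφ)).2.2
  have hd1 : ∀ t, HasDerivAt φ (deriv φ t) t := fun t =>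
    (hφ.differentiable (by norm_num) t).hasDerivAt
  have hd2 : ∀ t, HasDerivAt (deriv φ) (deriv (deriv φ) t) t := fun t =>
    (hφ1.differentiable (by norm_num) t).hasDerivAt
  have hcont : Continuous (deriv (deriv φ)) := hφ1.continuous_deriv (by norm_num)
  -- On `(0, ε]` the factor `φ''(log r)` vanishes, so the singularity at `0` is avoided.
  obtain ⟨ε, hε0, hερ, hεT⟩ : ∃ ε, 0 < ε ∧ ε ≤ ρ ∧ Real.log ε < T := by
    refine ⟨min ρ (Real.exp (T - 1)), by positivity, min_le_left _ _, ?_⟩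
    have := Real.log_le_log (by positivity) (min_le_right ρ (Real.exp (T - 1)))
    rw [Real.log_exp] at this
    linarith
  set g : ℝ → ℝ := fun r =>
    r * (Real.log (max r ρ) * (deriv (deriv φ) (Real.log r) * (r ^ 2)⁻¹)) with hg
  have hR : 0 < R := hρ.trans_le hρR
  have hlogd : ∀ r, 0 < r → HasDerivAt (fun r => deriv φ (Real.log r))
      (deriv (deriv φ) (Real.log r) * r⁻¹) r := fun r hr =>
    (hd2 (Real.log r)).comp r (Real.hasDerivAt_log hr.ne')
  have hcl : ContinuousOn (fun r => deriv (deriv φ) (Real.log r) * r⁻¹) (Ioi 0) := by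
    have h1 : ContinuousOn Real.log (Ioi 0) :=
      Real.continuousOn_log.mono fun x hx => (ne_of_gt hx : x ≠ 0)
    exact (hcont.comp_continuousOn h1).mul
      (continuousOn_inv₀.mono fun x hx => (ne_of_gt hx : x ≠ 0))
  have hlog : ContinuousOn Real.log (Ioi 0) :=
    Real.continuousOn_log.mono fun x hx => (ne_of_gt hx : x ≠ 0)
  have hsub : ∀ {a b : ℝ}, 0 < a → a ≤ b → uIcc a b ⊆ Ioi 0 := fun ha hab x hx => by
    rw [uIcc_of_le hab] at hx
    exact ha.trans_le hx.1
  have e1 : EqOn g (fun _ => 0) (uIcc 0 ε) := fun r hr => by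
    rw [uIcc_of_le hε0.le] at hr
    rcases hr.1.eq_or_lt with h | h
    · simp [hg, ← h]
    · simp [hg, hdd0 (Real.log r) ((Real.log_le_log h hr.2).trans_lt hεT)]
  have e2 : EqOn g (fun r => Real.log ρ * (deriv (deriv φ) (Real.log r) * r⁻¹)) (uIcc ε ρ) :=
    fun r hr => by
      have h0 : 0 < r := hsub hε0 hερ hr
      rw [uIcc_of_le hερ] at hr
      simp only [hg, max_eq_right hr.2]
      field_simp
  have e3 : EqOn g (fun r => Real.log r * (deriv (deriv φ) (Real.log r) * r⁻¹)) (uIcc ρ R) :=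
    fun r hr => by
      have h0 : 0 < r := hsub hρ hρR hr
      rw [uIcc_of_le hρR] at hr
      simp only [hg, max_eq_left hr.1]
      field_simp
  have c2 : ContinuousOn (fun r => Real.log ρ * (deriv (deriv φ) (Real.log r) * r⁻¹))
      (uIcc ε ρ) := (continuousOn_const.mul hcl).mono (hsub hε0 hερ)
  have c3 : ContinuousOn (fun r => Real.log r * (deriv (deriv φ) (Real.log r) * r⁻¹))
      (uIcc ρ R) := (hlog.mul hcl).mono (hsub hρ hρR)
  have i1 : IntervalIntegrable g volume 0 ε :=
    (continuousOn_const.congr e1).intervalIntegrable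
  have i2 : IntervalIntegrable g volume ε ρ := (c2.congr e2).intervalIntegrable
  have i3 : IntervalIntegrable g volume ρ R := (c3.congr e3).intervalIntegrable
  have v1 : ∫ r in (0 : ℝ)..ε, g r = 0 := by
    rw [intervalIntegral.integral_congr e1]
    simp
  have v2 : ∫ r in ε..ρ, g r = Real.log ρ * deriv φ (Real.log ρ) := by
    rw [intervalIntegral.integral_congr e2,
      intervalIntegral.integral_eq_sub_of_hasDerivAt
        (f := fun r => Real.log ρ * deriv φ (Real.log r))
        (fun r hr => (hlogd r (hsub hε0 hερ hr)).const_mul _) c2.intervalIntegrable,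
      hd0 _ hεT]
    ring
  have v3 : ∫ r in ρ..R, g r = (Real.log R * deriv φ (Real.log R) - φ (Real.log R)) -
      (Real.log ρ * deriv φ (Real.log ρ) - φ (Real.log ρ)) := by
    rw [intervalIntegral.integral_congr e3,
      intervalIntegral.integral_eq_sub_of_hasDerivAt
        (f := fun r => Real.log r * deriv φ (Real.log r) - φ (Real.log r))
        (fun r hr => ?_) c3.intervalIntegrable]
    have h0 : 0 < r := hsub hρ hρR hr
    have h1 := Real.hasDerivAt_log h0.ne'
    convert! (h1.mul (hlogd r h0)).sub ((hd1 (Real.log r)).comp r h1) using 1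
    ring
  rw [← integral_Ioc_eq_integral_Ioo, ← intervalIntegral.integral_of_le hR.le,
    ← intervalIntegral.integral_add_adjacent_intervals (i1.trans i2) i3,
    ← intervalIntegral.integral_add_adjacent_intervals i1 i2, v1, v2, v3]
  ring

/-- The pairing of the logarithmic kernel with pole `ζ` with a radial second derivative. -/
theorem integral_ball_log_norm_sub_mul {φ : ℝ → ℝ} (hφ : ContDiff ℝ 2 φ) {c : ℝ}
    (hconst : ∀ᶠ t in atBot, φ t = c) {ζ : ℂ} {R : ℝ} (hζ0 : ζ ≠ 0) (hζR : ‖ζ‖ ≤ R)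
    (hint : IntegrableOn (fun z : ℂ => Real.log ‖z - ζ‖ *
      (deriv (deriv φ) (Real.log ‖z‖) * (‖z‖ ^ 2)⁻¹)) (Metric.ball 0 R)) :
    ∫ z in Metric.ball (0 : ℂ) R, Real.log ‖z - ζ‖ *
      (deriv (deriv φ) (Real.log ‖z‖) * (‖z‖ ^ 2)⁻¹) = 2 * Real.pi *
        (Real.log R * deriv φ (Real.log R) - φ (Real.log R) + φ (Real.log ‖ζ‖)) := by
  have hm : Measurable (fun z : ℂ => Real.log ‖z - ζ‖ *
      (deriv (deriv φ) (Real.log ‖z‖) * (‖z‖ ^ 2)⁻¹)) := by fun_prop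
  have hρ : 0 < ‖ζ‖ := norm_pos_iff.2 hζ0
  rw [← integral_indicator measurableSet_ball,
    integral_eq_integral_circleAverage (hm.indicator measurableSet_ball)
      (hint.integrable_indicator measurableSet_ball),
    ← integral_log_max_mul_deriv_deriv hφ hconst hρ hζR, integral_const_mul]
  congr 1
  have hIoo : Ioo (0 : ℝ) R = Ioi 0 ∩ Iio R := rfl
  rw [hIoo, ← setIntegral_indicator measurableSet_Iio]
  refine setIntegral_congr_fun measurableSet_Ioi fun r hr => ?_
  have hr0 : 0 < r := hr
  have hnorm : ∀ z ∈ Metric.sphere (0 : ℂ) |r|, ‖z‖ = r := fun z hz => by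
    rw [mem_sphere_zero_iff_norm.1 hz, abs_of_pos hr0]
  by_cases hrR : r < R
  -- The weight is constant on the circle and leaves the average.
  · rw [indicator_of_mem (show r ∈ Iio R from hrR), ← circleAverage_log_norm_sub_eq_log_max hr0,
      mul_comm (Real.circleAverage _ _ _) _, ← smul_eq_mul (_ * _) (Real.circleAverage _ _ _),
      ← Real.circleAverage_smul]
    congr 1
    refine Real.circleAverage_congr_sphere fun z hz => ?_
    have hz' : z ∈ Metric.ball (0 : ℂ) R := by rwa [mem_ball_zero_iff, hnorm z hz]
    simp only [indicator_of_mem hz', hnorm z hz, Pi.smul_apply, smul_eq_mul]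
    ring
  · rw [indicator_of_notMem (show r ∉ Iio R from hrR)]
    have : Real.circleAverage ((Metric.ball (0 : ℂ) R).indicator fun z : ℂ => Real.log ‖z - ζ‖ *
        (deriv (deriv φ) (Real.log ‖z‖) * (‖z‖ ^ 2)⁻¹)) 0 r =
        Real.circleAverage (fun _ => 0) 0 r := by
      refine Real.circleAverage_congr_sphere fun z hz => ?_
      have hz' : z ∉ Metric.ball (0 : ℂ) R := by rwa [mem_ball_zero_iff, hnorm z hz]
      exact indicator_of_notMem hz' _
    rw [this, Real.circleAverage_const, mul_zero]

/-! ### Fubini against the equilibrium measure. -/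

/-- A bounded weight times the logarithmic kernel is integrable against area on a ball times a
probability measure of bounded support. -/
theorem integrable_log_norm_sub_mul {μ : Measure ℂ} [IsFiniteMeasure μ] {w : ℂ → ℝ}
    {R s B : ℝ} (hμ : ∀ᵐ ζ ∂μ, ‖ζ‖ ≤ s) (hw : Measurable w)
    (hB : ∀ z ∈ Metric.ball (0 : ℂ) R, |w z| ≤ B) :
    Integrable (fun p : ℂ × ℂ => Real.log ‖p.1 - p.2‖ * w p.1)
      ((volume.restrict (Metric.ball 0 R)).prod μ) := by
  have hm : Measurable fun p : ℂ × ℂ => Real.log ‖p.1 - p.2‖ * w p.1 := by fun_prop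
  refine ⟨hm.aestronglyMeasurable, ?_⟩
  rw [HasFiniteIntegral, lintegral_prod_symm' _ hm.enorm]
  have hM := (integrableOn_log_norm_ball (R + s)).hasFiniteIntegral
  rw [HasFiniteIntegral] at hM
  set M := ∫⁻ z in Metric.ball (0 : ℂ) (R + s), ‖Real.log ‖z‖‖ₑ
  have hle : ∀ᵐ ζ ∂μ, ∫⁻ z in Metric.ball (0 : ℂ) R, ‖Real.log ‖z - ζ‖ * w z‖ₑ ≤
      M * ENNReal.ofReal B := by
    filter_upwards [hμ] with ζ hζ
    calc ∫⁻ z in Metric.ball (0 : ℂ) R, ‖Real.log ‖z - ζ‖ * w z‖ₑ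
        ≤ ∫⁻ z in Metric.ball (0 : ℂ) R, ‖Real.log ‖z - ζ‖‖ₑ * ENNReal.ofReal B := by
          refine setLIntegral_mono' measurableSet_ball fun z hz => ?_
          rw [enorm_mul]
          gcongr
          rw [← ofReal_norm]
          exact ENNReal.ofReal_le_ofReal (hB z hz)
      _ = (∫⁻ z in Metric.ball (0 : ℂ) R, ‖Real.log ‖z - ζ‖‖ₑ) * ENNReal.ofReal B :=
          lintegral_mul_const _ (by fun_prop)
      _ ≤ M * ENNReal.ofReal B := by
          gcongr
          exact lintegral_ball_log_norm_sub_le hζ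
  refine lt_of_le_of_lt (lintegral_mono_ae hle) ?_
  rw [lintegral_const]
  exact ENNReal.mul_lt_top (ENNReal.mul_lt_top hM ENNReal.ofReal_lt_top) (measure_lt_top μ _)

/-- In `t = log|z|` the weight is `φ''(t)e^{-2t}`, which is continuous and vanishes near `-∞`. At `z
= 0` the convention `0⁻¹ = 0` makes it `0`. -/
theorem exists_abs_deriv_deriv_log_norm_le {φ : ℝ → ℝ} (hφ : ContDiff ℝ 2 φ) {c : ℝ}
    (hconst : ∀ᶠ t in atBot, φ t = c) (R : ℝ) : ∃ B, ∀ z ∈ Metric.ball (0 : ℂ) R,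
      |deriv (deriv φ) (Real.log ‖z‖) * (‖z‖ ^ 2)⁻¹| ≤ B := by
  have hφ1 : ContDiff ℝ 1 (deriv φ) :=
    ((contDiff_succ_iff_deriv (n := 1)).1 (by simpa [one_add_one_eq_two] using hφ)).2.2
  have hcont : Continuous (deriv (deriv φ)) := hφ1.continuous_deriv (by norm_num)
  obtain ⟨T, hT⟩ := eventually_atBot.1 hconst
  have h0 : ∀ᶠ t in atBot, deriv (deriv φ) t * (Real.exp t ^ 2)⁻¹ = 0 := by
    filter_upwards [Iio_mem_atBot T] with t ht
    rw [deriv_eq_zero_of_forall_lt_eq (deriv_eq_zero_of_forall_lt_eq fun u hu => hT u hu.le) t ht,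
      zero_mul]
  obtain ⟨B, hB0, hB⟩ := Continuous.exists_abs_le_of_eventuallyEq_const_atBot
    (ψ := fun t => deriv (deriv φ) t * (Real.exp t ^ 2)⁻¹)
    (hcont.mul (Continuous.inv₀ (by fun_prop) fun t => by positivity)) h0 (Real.log R)
  refine ⟨B, fun z hz => ?_⟩
  rcases eq_or_ne z 0 with rfl | hz0
  · simpa using hB0
  · have hpos : 0 < ‖z‖ := norm_pos_iff.2 hz0
    have := hB (Real.log ‖z‖) (Real.log_le_log hpos (mem_ball_zero_iff.1 hz).le)
    rwa [Real.exp_log hpos] at this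

theorem mainTheorem9 (K : Set ℂ) (hK : IsCompact K) (hconn : IsConnected K)
    (h0 : (0 : ℂ) ∈ K) (hcap : logCapacity K = 1)
    (φ : ℝ → ℝ) (hφ : ContDiff ℝ 2 φ) (hconst : ∃ c : ℝ, ∀ᶠ t in atBot, φ t = c)
    (R : ℝ) (hR : 4 ≤ R) :
    IntegrableOn (fun z : ℂ => φ (Real.log ‖z‖)) K (equilibriumMeasure K) ∧
    IntegrableOn (fun z : ℂ => equilibriumPotential K z *
      iteratedDeriv 2 φ (Real.log ‖z‖) * (‖z‖ ^ 2)⁻¹) (Metric.ball 0 R) volume ∧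
    ∫ z in K, φ (Real.log ‖z‖) ∂(equilibriumMeasure K) =
      (1 / (2 * Real.pi)) * (∫ z in Metric.ball (0 : ℂ) R, equilibriumPotential K z *
        iteratedDeriv 2 φ (Real.log ‖z‖) * (‖z‖ ^ 2)⁻¹)
      + φ (Real.log R) - deriv φ (Real.log R) * Real.log R := by
  obtain ⟨c, hc⟩ := hconst
  have hμ := isEquilibriumMeasure_equilibriumMeasure hK ⟨0, h0⟩
  have hE := logEnergy_equilibriumMeasure_of_logCapacity_eq_one hcap
  simp only [equilibriumPotential]
  set μ := equilibriumMeasure K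
  have hprob : IsProbabilityMeasure μ := hμ.1.1
  have haeK : ∀ᵐ ζ ∂μ, ζ ∈ K := hμ.1.2
  rw [IntegrableOn, Measure.restrict_eq_self_of_ae_mem haeK]
  have hae4 : ∀ᵐ ζ ∂μ, ‖ζ‖ ≤ 4 := by
    filter_upwards [haeK] with ζ hζ
    exact norm_le_four_of_logCapacity_eq_one hK hconn h0 hcap hζ
  -- Excluding `0` matters: `Real.log 0 = 0` would give `φ 0` there instead of the limit of `φ` at
  -- `-∞`.
  have hae0 : ∀ᵐ ζ ∂μ, ζ ≠ 0 := by
    have : μ {0} = 0 := hμ.1.measure_singleton_eq_zero hK (by rw [hE]; simp) 0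
    exact compl_mem_ae_iff.2 this
  have hφc : Continuous φ := hφ.continuous
  have hφint : Integrable (fun z : ℂ => φ (Real.log ‖z‖)) μ := by
    obtain ⟨B, -, hB⟩ := hφc.exists_abs_le_of_eventuallyEq_const_atBot hc (Real.log 4)
    refine Integrable.of_bound
      (hφc.measurable.comp (by fun_prop : Measurable fun z : ℂ => Real.log ‖z‖)).aestronglyMeasurable
      B ?_
    filter_upwards [hae4, hae0] with ζ h4 hz
    exact hB _ (Real.log_le_log (norm_pos_iff.2 hz) h4)
  have hdd : iteratedDeriv 2 φ = deriv (deriv φ) := by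
    rw [iteratedDeriv_succ, iteratedDeriv_one]
  rw [hdd]
  set w : ℂ → ℝ := fun z => deriv (deriv φ) (Real.log ‖z‖) * (‖z‖ ^ 2)⁻¹ with hw
  have hwm : Measurable w := by fun_prop
  obtain ⟨B, hB⟩ := exists_abs_deriv_deriv_log_norm_le hφ hc R
  have hint := integrable_log_norm_sub_mul hae4 hwm hB
  have hpot : ∀ z, (∫ ζ, Real.log ‖z - ζ‖ ∂μ) * deriv (deriv φ) (Real.log ‖z‖) * (‖z‖ ^ 2)⁻¹ =
      ∫ ζ, Real.log ‖z - ζ‖ * w z ∂μ := fun z => by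
    rw [integral_mul_const, mul_assoc]
  simp only [hpot]
  refine ⟨hφint, hint.integral_prod_left, ?_⟩
  have hinner : ∀ᵐ ζ ∂μ, ∫ z in Metric.ball (0 : ℂ) R, Real.log ‖z - ζ‖ * w z =
      2 * Real.pi * (Real.log R * deriv φ (Real.log R) - φ (Real.log R) + φ (Real.log ‖ζ‖)) := by
    filter_upwards [hae4, hae0, hint.prod_left_ae] with ζ h4 hz hi
    exact integral_ball_log_norm_sub_mul hφ hc hz (h4.trans hR) hi
  rw [integral_integral_swap hint, integral_congr_ae hinner, integral_const_mul,
    integral_add (integrable_const _) hφint]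
  have := Real.pi_ne_zero
  simp only [integral_const, probReal_univ, smul_eq_mul, one_mul]
  field_simp
  ring
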